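/- Let $S$ be a commutative semigroup with zero, written additively, with an involution $s\mapsto s^*$ (so $s^{**}=s$, $(s+t)^*=s^*+t^*$). A character of $S$ is a nonzero map $\sigma:S\to\mathbb C$ with $\sigma(s+t)=\sigma(s)\sigma(t)$ and $\sigma(s^*)=\overline{\sigma(s)}$; $S^*$ is the set of characters, with the least $\sigma$-algebra making all evaluations $\sigma\mapsto\sigma(s)$ measurable. Write $s\sim t$ if $\sigma(s)=\sigma(t)$ for all $\sigma\in S^*$, and $[s]$ for the class of $s$ in the quotient semigroup $S/\!\sim$. Let $\mathfrak P(S)$ be the set of positive definite functions, i.e. $\varphi:S\to\mathbb C$ with $\sum_{i,j=0}^N\xi_i\overline{\xi_j}\,\varphi(s_j^*+s_i)\ge 0$ for all $N\in\mathbb N$, $s_0,\dots,s_N\in S$, $\xi_0,\dots,\xi_N\in\mathbb C$, and let $\mathfrak M(S)\subseteq\mathfrak P(S)$ be the set of moment functions $\varphi(s)=\int_{S^*}\sigma(s)\,d\mu(\sigma)$, where $\mu$ is a positive measure on $S^*$ for which all evaluations are square-integrable. For $\varphi\in\mathfrak P(S)$ let $\mathcal H^\varphi$ be the reproducing kernel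 Hilbert space with kernel $K(s,t)=\varphi(t^*+s)$ and kernel functions $K_s=K(\cdot,s)$, and for $u\in S$ let $u_\varphi$ be the closure of the operator $\sum_j\xi_jK_{s_j}\mapsto\sum_j\xi_jK_{s_j+u}$ defined on the linear span of the $K_s$. For $\psi:S\to\mathbb C$ with $\psi(s)=\overline{\psi(s^*)}$, the number of negative squares of $\psi$ is the maximum (possibly $\infty$), over all $N\in\mathbb N$ and $s_0,\dots,s_N\in S$, of the number of negative eigenvalues, counted with multiplicity, of the Hermitian matrix $(\psi(s_i+s_j^*))_{i,j=0}^N$. Let $u\in S$ satisfy $[2u]=0$ and $[u]=[u^*]$. Then for every $\varphi\in\mathfrak P(S)$ the function $\psi=\varphi(\cdot+u)$ satisfies $\psi(s)=\overline{\psi(s^*)}$ for all $s\in S$, and its number of negative squares equals $\dim\ker(u_\varphi+I)$ (both being $\infty$ if one is). Moreover, the following conditions are equivalent: (i) the set $\{[s]\in S/\!\sim\;:\;[u+s]\ne[s]\}$ is finite; (ii) $\sigma(u)=-1$ for only finitely many $\sigma\in S^*$; (iii) $\dim\ker(u_\varphi+I)<\infty$ for all $\varphi\in\mathfrak M(S)$;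 (iv) $\dim\ker(u_\varphi+I)<\infty$ for all $\varphi\in\mathfrak P(S)$; (v) $\varphi(\cdot+u)$ has a finite number of negative squares for every $\varphi\in\mathfrak P(S)$; (vi) $\varphi(\cdot+u)$ has a finite number of negative squares for every $\varphi\in\mathfrak M(S)$. -/

import Mathlib

open scoped ComplexConjugate ComplexOrder

noncomputable section

namespace StarSemigroup

variable {S : Type*} [AddCommMonoid S] [StarAddMonoid S]

/-! A commutative star-semigroup with zero, written additively, is a type `S` with
`[AddCommMonoid S] [StarAddMonoid S]`. -/

/-- A character: a nonzero star-homomorphism into `ℂ` with multiplication and conjugation. -/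
structure Character (S : Type*) [AddCommMonoid S] [StarAddMonoid S] where
  toFun : S → ℂ
  map_add' : ∀ s t, toFun (s + t) = toFun s * toFun t
  map_star' : ∀ s, toFun (star s) = conj (toFun s)
  ne_zero' : ∃ s, toFun s ≠ 0

instance : CoeFun (Character S) (fun _ => S → ℂ) := ⟨Character.toFun⟩

/-- The least sigma-algebra on the dual for which all evaluations `σ ↦ σ s` are measurable. -/
instance : MeasurableSpace (Character S) :=
  ⨆ s : S, MeasurableSpace.comap (fun σ : Character S => σ s) inferInstance

/-- The congruence `s ∼ t` iff `σ s = σ t` for all characters `σ`. -/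
def charCon (S : Type*) [AddCommMonoid S] [StarAddMonoid S] : AddCon S where
  r s t := ∀ σ : Character S, σ s = σ t
  iseqv := ⟨fun _ _ => rfl, fun h σ => (h σ).symm, fun h k σ => (h σ).trans (k σ)⟩
  add' h k σ := by rw [σ.map_add', σ.map_add', h σ, k σ]

/-- The quotient semigroup `S/∼`. -/
abbrev SepQuotient (S : Type*) [AddCommMonoid S] [StarAddMonoid S] : Type _ :=
  (charCon S).Quotient

/-- The class `[s]` in `S/∼`. -/
def cls (s : S) : SepQuotient S := (s : (charCon S).Quotient)

/-- Positive definite functions (the order on `ℂ` makes `0 ≤ z` mean: `z` is real and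
nonnegative). -/
def IsPosDef (φ : S → ℂ) : Prop :=
  ∀ (N : ℕ) (s : Fin (N + 1) → S) (ξ : Fin (N + 1) → ℂ),
    0 ≤ ∑ i, ∑ j, ξ i * conj (ξ j) * φ (star (s j) + s i)

/-- Moment functions: `φ s = ∫ σ s dμ(σ)` for a positive measure `μ` on the dual for which all
evaluations are square-integrable. -/
def IsMoment (φ : S → ℂ) : Prop :=
  ∃ μ : MeasureTheory.Measure (Character S),
    (∀ s : S, MeasureTheory.MemLp (fun σ : Character S => σ s) 2 μ) ∧
    ∀ s : S, φ s = ∫ σ : Character S, σ s ∂μ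

/-! Positive definite functions give positive semidefinite kernels. -/

theorem IsPosDef.sum_nonneg {φ : S → ℂ} (hφ : IsPosDef φ) {ι : Type*} [Fintype ι]
    (s : ι → S) (ξ : ι → ℂ) :
    0 ≤ ∑ i, ∑ j, ξ i * conj (ξ j) * φ (star (s j) + s i) := by
  rcases isEmpty_or_nonempty ι with h | h
  · simp
  · obtain ⟨N, hN⟩ : ∃ N, Fintype.card ι = N + 1 :=
      Nat.exists_eq_succ_of_ne_zero Fintype.card_ne_zero
    let e : Fin (N + 1) ≃ ι := (finCongr hN.symm).trans (Fintype.equivFin ι).symm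
    have := hφ N (s ∘ e) (ξ ∘ e)
    rw [← e.sum_comp]
    simp_rw [← e.sum_comp (fun j => _ * conj (ξ j) * φ (star (s j) + s _))]
    exact this

theorem IsPosDef.conj_symm {φ : S → ℂ} (hφ : IsPosDef φ) (s t : S) :
    φ (star t + s) = conj (φ (star s + t)) := by
  have ha := hφ 0 ![s] ![1]
  have hb := hφ 0 ![t] ![1]
  have h1 := hφ 1 ![s, t] ![1, 1]
  have h2 := hφ 1 ![s, t] ![1, Complex.I]
  simp [Fin.sum_univ_two, Complex.le_def] at ha hb h1 h2
  apply Complex.ext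
  · simp
    linarith [h1.2, h2.2, ha.2, hb.2]
  · simp
    linarith [h1.2, h2.2, ha.2, hb.2]

/-- The kernel `K(s, t) = φ (t* + s)`, its values acting on `ℂ` by multiplication. -/
def kernelMatrix (φ : S → ℂ) : Matrix S S (ℂ →L[ℂ] ℂ) :=
  Matrix.of fun s t => φ (star t + s) • ContinuousLinearMap.id ℂ ℂ

theorem IsPosDef.posSemidef {φ : S → ℂ} (hφ : IsPosDef φ) : (kernelMatrix φ).PosSemidef := by
  refine ((RKHS.posSemidef_tfae (K := kernelMatrix φ)).out 0 2 rfl rfl).mpr ⟨?_, fun v => ?_⟩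
  · ext s t
    have h := hφ.conj_symm t s
    have h1 : star (ContinuousLinearMap.id ℂ ℂ) = ContinuousLinearMap.id ℂ ℂ := star_one (ℂ →L[ℂ] ℂ)
    simp [kernelMatrix, h, h1]
  · have h := hφ.sum_nonneg (ι := v.support) (fun i => i.1) (fun i => conj (v i.1))
    have h' := (Complex.le_def.mp h).1
    rw [Complex.zero_re, ← Complex.conj_re] at h'
    refine h'.trans_eq (congrArg Complex.re ?_)
    simp only [Finsupp.sum, kernelMatrix, Matrix.of_apply, map_sum, map_mul, Complex.conj_conj]
    rw [← Finset.sum_coe_sort v.support, Finset.sum_comm]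
    refine Finset.sum_congr rfl fun i _ => ?_
    rw [← Finset.sum_coe_sort v.support]
    refine Finset.sum_congr rfl fun j _ => ?_
    simp
    ring

/-- Moment functions are positive definite. -/
theorem IsMoment.isPosDef {φ : S → ℂ} (h : IsMoment φ) : IsPosDef φ := by
  obtain ⟨μ, hL, hφ⟩ := h
  intro N s ξ
  have hint : ∀ i j, MeasureTheory.Integrable
      (fun σ : Character S => ξ i * conj (ξ j) * σ (star (s j) + s i)) μ := by
    intro i j
    have h1 : MeasureTheory.Integrable
        (fun σ : Character S => conj (σ (s j)) * σ (s i)) μ :=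
      MeasureTheory.MemLp.integrable_mul (hL (s j)).star (hL (s i))
    refine (h1.const_mul (ξ i * conj (ξ j))).congr (Filter.Eventually.of_forall fun σ => ?_)
    simp only [σ.map_add', σ.map_star']
  have key : ∑ i, ∑ j, ξ i * conj (ξ j) * φ (star (s j) + s i) =
      ∫ σ : Character S, ((‖∑ i, ξ i * σ (s i)‖ ^ 2 : ℝ) : ℂ) ∂μ := by
    have h2 : ∀ σ : Character S, ((‖∑ i, ξ i * σ (s i)‖ ^ 2 : ℝ) : ℂ) =
        ∑ i, ∑ j, ξ i * conj (ξ j) * σ (star (s j) + s i) := by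
      intro σ
      rw [Complex.ofReal_pow, ← Complex.mul_conj', map_sum, Finset.sum_mul_sum]
      refine Finset.sum_congr rfl fun i _ => Finset.sum_congr rfl fun j _ => ?_
      rw [σ.map_add', σ.map_star', map_mul]
      ring
    simp_rw [h2, hφ, ← MeasureTheory.integral_const_mul]
    rw [MeasureTheory.integral_finsetSum _
      fun i _ => MeasureTheory.integrable_finsetSum _ fun j _ => hint i j]
    exact Finset.sum_congr rfl fun i _ =>
      (MeasureTheory.integral_finsetSum _ fun j _ => hint i j).symm
  rw [key, integral_complex_ofReal]
  exact_mod_cast MeasureTheory.integral_nonneg fun σ => by positivity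

/-- The reproducing kernel Hilbert space of a positive definite function `φ`: the Hilbert space of
functions on `S` with reproducing kernel `K(s, t) = φ (t* + s)`. -/
def Hsp {φ : S → ℂ} (hφ : IsPosDef φ) : Type _ :=
  haveI : Fact (kernelMatrix φ).PosSemidef := ⟨hφ.posSemidef⟩
  RKHS.OfKernel (kernelMatrix φ)

section Hsp

variable {φ : S → ℂ} (hφ : IsPosDef φ)

instance : NormedAddCommGroup (Hsp hφ) :=
  haveI : Fact (kernelMatrix φ).PosSemidef := ⟨hφ.posSemidef⟩
  inferInstanceAs (NormedAddCommGroup (RKHS.OfKernel (kernelMatrix φ)))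

instance : InnerProductSpace ℂ (Hsp hφ) :=
  haveI : Fact (kernelMatrix φ).PosSemidef := ⟨hφ.posSemidef⟩
  inferInstanceAs (InnerProductSpace ℂ (RKHS.OfKernel (kernelMatrix φ)))

instance : CompleteSpace (Hsp hφ) :=
  haveI : Fact (kernelMatrix φ).PosSemidef := ⟨hφ.posSemidef⟩
  inferInstanceAs (CompleteSpace (RKHS.OfKernel (kernelMatrix φ)))

instance : RKHS ℂ (Hsp hφ) S ℂ :=
  haveI : Fact (kernelMatrix φ).PosSemidef := ⟨hφ.posSemidef⟩
  inferInstanceAs (RKHS ℂ (RKHS.OfKernel (kernelMatrix φ)) S ℂ)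

theorem kernel_Hsp : RKHS.kernel (Hsp hφ) = kernelMatrix φ :=
  haveI : Fact (kernelMatrix φ).PosSemidef := ⟨hφ.posSemidef⟩
  RKHS.OfKernel.kernel_ofKernel (K := kernelMatrix φ)

/-- The kernel function `K_s = K(·, s)` as an element of the space. -/
def kerVec (s : S) : Hsp hφ := RKHS.kerFun (Hsp hφ) s 1

theorem kerVec_apply (s t : S) : kerVec hφ s t = φ (star s + t) := by
  rw [kerVec, RKHS.kerFun_apply, kernel_Hsp]
  simp [kernelMatrix]

/-- The reproducing property. -/
theorem inner_kerVec (s : S) (f : Hsp hφ) : inner ℂ (kerVec hφ s) f = f s := by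
  simp [kerVec]

/-- The graph of the shift operator `A(u, φ)`: the linear span of the pairs `(K_s, K_{s+u})`. -/
def shiftGraph (u : S) : Submodule ℂ (Hsp hφ × Hsp hφ) :=
  Submodule.span ℂ (Set.range fun s => (kerVec hφ s, kerVec hφ (s + u)))

/-- The shift operator `A(u, φ)`, with domain the span of the `K_s`, sending `∑ ξ_j K_{s_j}` to
`∑ ξ_j K_{s_j+u}`. -/
def shiftOp (u : S) : Hsp hφ →ₗ.[ℂ] Hsp hφ := (shiftGraph hφ u).toLinearPMap

theorem shiftGraph_le (u : S) (p : Hsp hφ × Hsp hφ) (hp : p ∈ (shiftGraph hφ u).topologicalClosure)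
    (t : S) : p.2 t = p.1 (star u + t) := by
  have hc : IsClosed {p : Hsp hφ × Hsp hφ | p.2 t = p.1 (star u + t)} :=
    isClosed_eq ((RKHS.continuous_eval t).comp continuous_snd)
      ((RKHS.continuous_eval (star u + t)).comp continuous_fst)
  refine closure_minimal (fun q hq => ?_) hc hp
  induction hq using Submodule.span_induction with
  | mem x hx =>
    obtain ⟨s, rfl⟩ := hx
    simp [kerVec_apply, add_assoc]
  | zero => simp
  | add x y _ _ hx hy => simp_all
  | smul a x _ hx => simp_all

/-- The shift operator is well defined: its graph is the span of the pairs `(K_s, K_{s+u})`. -/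
theorem graph_shiftOp (u : S) : (shiftOp hφ u).graph = shiftGraph hφ u := by
  refine Submodule.toLinearPMap_graph_eq _ fun p hp h0 => RKHS.ext fun t => ?_
  rw [shiftGraph_le hφ u p (Submodule.le_topologicalClosure _ hp) t, h0]
  simp

/-- The domain of the shift operator is the linear span of the kernel functions. -/
theorem domain_shiftOp (u : S) :
    (shiftOp hφ u).domain = Submodule.span ℂ (Set.range (kerVec hφ)) := by
  rw [shiftOp, Submodule.toLinearPMap_domain, shiftGraph, Submodule.map_span, ← Set.range_comp]
  rfl

/-- The shift operator is closable. -/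
theorem shiftOp_isClosable (u : S) : (shiftOp hφ u).IsClosable := by
  refine ⟨(shiftGraph hφ u).topologicalClosure.toLinearPMap, ?_⟩
  rw [graph_shiftOp, Submodule.toLinearPMap_graph_eq]
  intro p hp h0
  refine RKHS.ext fun t => ?_
  rw [shiftGraph_le hφ u p hp t, h0]
  simp

/-- The operator `u_φ`: the closure of the shift operator. -/
def shiftClosure (u : S) : Hsp hφ →ₗ.[ℂ] Hsp hφ := (shiftOp hφ u).closure

/-- The kernel of `u_φ + I`, a subspace of the domain of `u_φ`. -/
def kerShiftAddId (u : S) : Submodule ℂ (shiftClosure hφ u).domain :=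
  LinearMap.ker ((shiftClosure hφ u).toFun + (shiftClosure hφ u).domain.subtype)

end Hsp

/-- The symmetry condition `ψ s = conj (ψ (s*))`. -/
def IsHermitianFun (ψ : S → ℂ) : Prop := ∀ s, ψ s = conj (ψ (star s))

/-- The number of negative eigenvalues of a square complex matrix, with multiplicity. -/
def negEigenvalueCount {n : ℕ} (M : Matrix (Fin n) (Fin n) ℂ) : ℕ :=
  (M.charpoly.roots.filter fun z => z.re < 0 ∧ z.im = 0).card

/-- The number of negative squares of `ψ` (meant for `ψ` with `IsHermitianFun ψ`), infinite if the
numbers of negative eigenvalues are unbounded. -/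
def negSquares (ψ : S → ℂ) : ℕ∞ :=
  ⨆ (N : ℕ) (s : Fin (N + 1) → S),
    (negEigenvalueCount (Matrix.of fun i j => ψ (s i + star (s j))) : ℕ∞)

end StarSemigroup

end

open scoped ComplexConjugate ComplexOrder

noncomputable section

namespace StarSemigroup

variable {S : Type*} [AddCommMonoid S] [StarAddMonoid S]

/-! ### Characters of abelian groups -/

/-! The pivot is that for every positive definite φ, moment function or not, the vector K_s depends
only on [s] (`kerVec_eq_of_forall_character_eq`). If all characters agree at s and t, then s and t
generate the same *-stable face. In its group of differences, circle-valued characters give s - t =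
X - Y with X = x + x*, Y = y + y*, and positive characters make s + s* - t - t* torsion. So X - Y is
torsion, convexity of φ along norms removes it, and common summands from the face cancel.

Consequently K_s ↦ K_{s+u} is a symmetric involution on the span of the K_s, and the Hermitian form
of φ(· + u) is its quadratic form. Its (-1)-eigenspace there is `antiSpan`, spanned by the K_s -
K_{s+u}. The dimension of that space is the number of negative squares, and passing to the closed
operator does not change it as an element of `ℕ∞`.

If only finitely many classes are moved by u, `antiSpan` has finitely many nonzero generators. If
σ(u) = -1 for finitely many σ, odd powers and products of characters limit the moved classes
(`finite_moved_classes`). If it holds for infinitely many, a pointwise bounded sequence of them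
carries a finite measure whose moment function satisfies φ(· + u) = -φ, and independence of
characters yields infinitely many negative squares (`exists_isMoment_negSquares_eq_top`). -/

theorem exists_addMonoidHom_circle_ne_one {A : Type*} [AddCommGroup A] {a : A} (ha : a ≠ 0) :
    ∃ χ : A →+ Additive Circle, χ a ≠ 0 := by
  obtain ⟨c, hc⟩ := CharacterModule.exists_character_apply_ne_zero_of_ne_zero ha
  let c' : A →+ AddCircle (1 : ℚ) := c
  let j : AddCircle (1 : ℚ) →+ AddCircle (1 : ℝ) :=
    QuotientAddGroup.map _ _ (Rat.castHom ℝ : ℚ →+ ℝ) (by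
      rintro _ ⟨n, rfl⟩
      exact ⟨n, by simp⟩)
  have hj : Function.Injective j := by
    rw [injective_iff_map_eq_zero]
    intro x hx
    induction x using QuotientAddGroup.induction_on with
    | H q =>
      have h1 : (((q : ℚ) : ℝ) : AddCircle (1 : ℝ)) = 0 := hx
      rw [AddCircle.coe_eq_zero_iff] at h1
      obtain ⟨n, hn⟩ := h1
      refine (AddCircle.coe_eq_zero_iff (p := (1 : ℚ))).mpr ⟨n, ?_⟩
      rw [zsmul_one] at hn ⊢
      exact_mod_cast hn
  let k : AddCircle (1 : ℝ) →+ Additive Circle :=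
    { toFun := fun x => Additive.ofMul (AddCircle.toCircle x)
      map_zero' := by simp
      map_add' := fun x y => by rw [AddCircle.toCircle_add]; rfl }
  have hk : Function.Injective k := fun x y h =>
    AddCircle.injective_toCircle one_ne_zero (Additive.ofMul.injective h)
  refine ⟨k.comp (j.comp c'), fun h => hc ?_⟩
  have h2 : k (j (c' a)) = k (j 0) := by rw [map_zero, map_zero]; exact h
  exact hj (hk h2)

/-- The subgroup generated by a is a copy of ℤ, and ℚ is divisible, hence injective, so ℤ → ℚ
extends to all of A. -/
theorem exists_addMonoidHom_real_ne_zero {A : Type*} [AddCommGroup A] {a : A}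
    (ha : ¬ IsOfFinAddOrder a) : ∃ f : A →+ ℝ, f a ≠ 0 := by
  let ι : ℤ →ₗ[ℤ] A := LinearMap.toSpanSingleton ℤ A a
  have hι : Function.Injective ι := by
    intro m n h
    exact (injective_zsmul_iff_not_isOfFinAddOrder.mpr ha) (by simpa [ι] using h)
  let g : ℤ →ₗ[ℤ] ℚ := (Int.castAddHom ℚ).toIntLinearMap
  obtain ⟨h, hh⟩ := (Module.Baer.of_divisible ℚ).extension_property ι hι g
  refine ⟨(Rat.castHom ℝ : ℚ →+ ℝ).comp h.toAddMonoidHom, ?_⟩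
  have h1 := LinearMap.congr_fun hh 1
  simp [ι, g] at h1
  simp [h1]

/-! ### Basic facts on characters -/

theorem Character.ext_fun {σ τ : Character S} (h : ∀ s, σ s = τ s) : σ = τ := by
  cases σ; cases τ
  congr
  exact funext h

theorem Character.map_zero (σ : Character S) : σ 0 = 1 := by
  obtain ⟨s, hs⟩ := σ.ne_zero'
  have := σ.map_add' s 0
  rw [add_zero] at this
  exact (mul_eq_left₀ hs).mp this.symm

open scoped Classical in
/-- A character of a `*`-stable face, extended by zero. -/
def Character.ofFace (F : AddSubmonoid S) (hF : ∀ x y, x + y ∈ F → x ∈ F)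
    (hs : ∀ x ∈ F, star x ∈ F) (χ : S → ℂ) (h0 : χ 0 ≠ 0)
    (hadd : ∀ x ∈ F, ∀ y ∈ F, χ (x + y) = χ x * χ y)
    (hstar : ∀ x ∈ F, χ (star x) = conj (χ x)) : Character S where
  toFun x := if x ∈ F then χ x else 0
  map_add' x y := by
    by_cases hx : x ∈ F
    · by_cases hy : y ∈ F
      · simp [hx, hy, F.add_mem hx hy, hadd x hx y hy]
      · have : x + y ∉ F := fun h => hy (hF y x (by rwa [add_comm]))
        simp [hy, this]
    · have : x + y ∉ F := fun h => hx (hF x y h)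
      simp [hx, this]
  map_star' x := by
    by_cases hx : x ∈ F
    · simp [hx, hs x hx, hstar x hx]
    · have : star x ∉ F := fun h => hx (by simpa using hs _ h)
      simp [hx, this]
  ne_zero' := ⟨0, by simpa using h0⟩

theorem Character.ofFace_of_mem {F : AddSubmonoid S} {hF hs} {χ : S → ℂ} {h0 hadd hstar} {x : S}
    (hx : x ∈ F) : Character.ofFace F hF hs χ h0 hadd hstar x = χ x :=
  if_pos hx

theorem Character.ofFace_of_notMem {F : AddSubmonoid S} {hF hs} {χ : S → ℂ} {h0 hadd hstar}
    {x : S} (hx : x ∉ F) : Character.ofFace F hF hs χ h0 hadd hstar x = 0 :=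
  if_neg hx

/-- The smallest `*`-stable face containing `s`. -/
def starFace (s : S) : AddSubmonoid S where
  carrier := {x | ∃ (n : ℕ) (y : S), x + y = n • (s + star s)}
  zero_mem' := ⟨0, 0, by simp⟩
  add_mem' := by
    rintro a b ⟨n, y, h⟩ ⟨m, z, k⟩
    refine ⟨n + m, y + z, ?_⟩
    rw [add_smul, ← h, ← k]
    abel

theorem self_mem_starFace (s : S) : s ∈ starFace s := ⟨1, star s, by simp⟩

theorem starFace_isFace (s x y : S) (h : x + y ∈ starFace s) : x ∈ starFace s := by
  obtain ⟨n, z, h⟩ := h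
  exact ⟨n, y + z, by rw [← h, add_assoc]⟩

theorem star_mem_starFace (s x : S) (h : x ∈ starFace s) : star x ∈ starFace s := by
  obtain ⟨n, z, h⟩ := h
  refine ⟨n, star z, ?_⟩
  rw [← star_add, h, star_nsmul, star_add, star_star, add_comm (star s)]

/-- The indicator function of the face is itself a character. -/
theorem mem_starFace_of_forall_character_eq {s t : S} (h : ∀ σ : Character S, σ s = σ t) :
    t ∈ starFace s := by
  by_contra ht
  have := h (Character.ofFace (starFace s) (starFace_isFace s) (star_mem_starFace s)
    (fun _ => 1) one_ne_zero (by simp) (by simp))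
  rw [Character.ofFace_of_mem (self_mem_starFace s), Character.ofFace_of_notMem ht] at this
  exact one_ne_zero this

open Algebra in
theorem grothendieckAddGroup_of_eq_iff {M : Type*} [AddCommMonoid M] (F : AddSubmonoid M) (a b : F) : GrothendieckAddGroup.of a = GrothendieckAddGroup.of b ↔
    ∃ c ∈ F, (c : M) + a = c + b := by
  have := (AddLocalization.addMonoidOf (⊤ : AddSubmonoid F)).eq_iff_exists (x := a) (y := b)
  refine this.trans ⟨fun ⟨c, hc⟩ => ⟨c.1.1, c.1.2, congrArg Subtype.val hc⟩, fun ⟨c, hc, h⟩ =>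
    ⟨⟨⟨c, hc⟩, trivial⟩, Subtype.ext h⟩⟩

open Algebra in
/-- The elements `x + x*` of a face, in its group of differences. -/
def normHom (F : AddSubmonoid S) (hs : ∀ x ∈ F, star x ∈ F) :
    F →+ GrothendieckAddGroup F :=
  GrothendieckAddGroup.of.comp
    { toFun := fun x => (⟨x + star (x : S), F.add_mem x.2 (hs _ x.2)⟩ : F)
      map_zero' := by ext; simp
      map_add' := fun x y => by ext; simp only [AddSubmonoid.coe_add, star_add]; abel }

open Algebra in
open scoped Classical in
/-- Characters separate points modulo elements of the form `x + x*`. -/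
theorem exists_norm_add_eq (F : AddSubmonoid S) (hF : ∀ x y, x + y ∈ F → x ∈ F)
    (hs : ∀ x ∈ F, star x ∈ F) {s t : S} (h : ∀ σ : Character S, σ s = σ t) (hsF : s ∈ F)
    (htF : t ∈ F) : ∃ x ∈ F, ∃ y ∈ F, ∃ c ∈ F,
      c + (s + (y + star y)) = c + (t + (x + star x)) := by
  let D : AddSubgroup (GrothendieckAddGroup F) := AddSubgroup.closure (Set.range (normHom F hs))
  have hD : ∀ g ∈ D, ∃ x y : F, g = normHom F hs x - normHom F hs y := by
    intro g hg
    induction hg using AddSubgroup.closure_induction with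
    | mem g hg => obtain ⟨x, rfl⟩ := hg; exact ⟨x, 0, by simp⟩
    | zero => exact ⟨0, 0, by simp⟩
    | add a b _ _ ha hb =>
      obtain ⟨x, y, rfl⟩ := ha
      obtain ⟨x', y', rfl⟩ := hb
      exact ⟨x + x', y + y', by simp only [map_add]; abel⟩
    | neg a _ ha =>
      obtain ⟨x, y, rfl⟩ := ha
      exact ⟨y, x, by abel⟩
  have key : GrothendieckAddGroup.of (⟨s, hsF⟩ : F) - GrothendieckAddGroup.of ⟨t, htF⟩ ∈ D := by
    by_contra hst
    rw [← QuotientAddGroup.eq_zero_iff] at hst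
    obtain ⟨c, hc⟩ := exists_addMonoidHom_circle_ne_one hst
    -- Killing D forces α(x*) = -α(x), which on the circle is complex conjugation; this makes χ
    -- compatible with the involution.
    let α : F →+ Additive Circle :=
      (c.comp (QuotientAddGroup.mk' D)).comp GrothendieckAddGroup.of
    let χ : S → ℂ := fun x => if hx : x ∈ F then ((α ⟨x, hx⟩).toMul : ℂ) else 0
    have hχ : ∀ x (hx : x ∈ F), χ x = ((α ⟨x, hx⟩).toMul : ℂ) := fun x hx => dif_pos hx
    have hαs : ∀ x (hx : x ∈ F), α ⟨star x, hs x hx⟩ = - α ⟨x, hx⟩ := by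
      intro x hx
      rw [eq_neg_iff_add_eq_zero, ← map_add]
      have h1 : normHom F hs ⟨x, hx⟩ ∈ D := AddSubgroup.subset_closure ⟨_, rfl⟩
      have h2 := (QuotientAddGroup.eq_zero_iff _).mpr h1
      have h3 : α (⟨star x, hs x hx⟩ + ⟨x, hx⟩) =
          c (normHom F hs ⟨x, hx⟩ : GrothendieckAddGroup F ⧸ D) := by
        rw [add_comm]; rfl
      rw [h3, h2, map_zero]
    have hσ := h (Character.ofFace F hF hs χ (by rw [hχ 0 F.zero_mem]; exact Circle.coe_ne_zero _)
      (fun x hx y hy => by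
        rw [hχ x hx, hχ y hy, hχ _ (F.add_mem hx hy), ← Circle.coe_mul, ← toMul_add, ← map_add]
        rfl)
      (fun x hx => by
        rw [hχ x hx, hχ _ (hs x hx), hαs x hx, toMul_neg, Circle.coe_inv_eq_conj]))
    rw [Character.ofFace_of_mem hsF, Character.ofFace_of_mem htF, hχ s hsF, hχ t htF] at hσ
    refine hc ?_
    have h4 : α ⟨s, hsF⟩ = α ⟨t, htF⟩ := Additive.toMul.injective (Circle.coe_injective hσ)
    rw [QuotientAddGroup.mk_sub, map_sub, sub_eq_zero]
    exact h4
  obtain ⟨x, y, hxy⟩ := hD _ key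
  refine ⟨x, x.2, y, y.2, ?_⟩
  rw [sub_eq_sub_iff_add_eq_add] at hxy
  have h5 : GrothendieckAddGroup.of
      (⟨s, hsF⟩ + ⟨y + star (y : S), F.add_mem y.2 (hs _ y.2)⟩ : F) =
      GrothendieckAddGroup.of (⟨t, htF⟩ + ⟨x + star (x : S), F.add_mem x.2 (hs _ x.2)⟩ : F) := by
    rw [map_add, map_add]
    exact hxy.trans (add_comm _ _)
  exact (grothendieckAddGroup_of_eq_iff F _ _).mp h5

open Algebra in
open scoped Classical in
/-- Positive characters separate the elements `s + s*` modulo torsion. -/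
theorem exists_nsmul_norm_add_eq (F : AddSubmonoid S) (hF : ∀ x y, x + y ∈ F → x ∈ F)
    (hs : ∀ x ∈ F, star x ∈ F) {s t : S} (h : ∀ σ : Character S, σ s = σ t) (hsF : s ∈ F)
    (htF : t ∈ F) : ∃ n : ℕ, 0 < n ∧ ∃ c ∈ F,
      c + n • (s + star s) = c + n • (t + star t) := by
  have key : IsOfFinAddOrder (normHom F hs ⟨s, hsF⟩ - normHom F hs ⟨t, htF⟩) := by
    by_contra hst
    obtain ⟨c, hc⟩ := exists_addMonoidHom_real_ne_zero hst
    -- Since x + x* is invariant under the involution, exp ∘ α is a positive, *-invariant character.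
    let α : F →+ ℝ := c.comp (normHom F hs)
    let χ : S → ℂ := fun x => if hx : x ∈ F then ((Real.exp (α ⟨x, hx⟩) : ℝ) : ℂ) else 0
    have hχ : ∀ x (hx : x ∈ F), χ x = ((Real.exp (α ⟨x, hx⟩) : ℝ) : ℂ) := fun x hx => dif_pos hx
    have hαs : ∀ x (hx : x ∈ F), α ⟨star x, hs x hx⟩ = α ⟨x, hx⟩ := by
      intro x hx
      have h3 : normHom F hs ⟨star x, hs x hx⟩ = normHom F hs ⟨x, hx⟩ := by
        simp [normHom, add_comm]
      simp only [α, AddMonoidHom.comp_apply, h3]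
    have hσ := h (Character.ofFace F hF hs χ
      (by rw [hχ 0 F.zero_mem]; exact_mod_cast Real.exp_ne_zero _)
      (fun x hx y hy => by
        rw [hχ x hx, hχ y hy, hχ _ (F.add_mem hx hy), ← Complex.ofReal_mul, ← Real.exp_add,
          ← map_add]
        rfl)
      (fun x hx => by
        rw [hχ x hx, hχ _ (hs x hx), hαs x hx, Complex.conj_ofReal]))
    rw [Character.ofFace_of_mem hsF, Character.ofFace_of_mem htF, hχ s hsF, hχ t htF] at hσ
    refine hc ?_
    rw [map_sub, sub_eq_zero]
    exact Real.exp_injective (Complex.ofReal_injective hσ)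
  rw [isOfFinAddOrder_iff_nsmul_eq_zero] at key
  obtain ⟨n, hn, h0⟩ := key
  refine ⟨n, hn, ?_⟩
  rw [nsmul_sub, sub_eq_zero] at h0
  have h5 : GrothendieckAddGroup.of
      (n • ⟨s + star s, F.add_mem hsF (hs _ hsF)⟩ : F) =
      GrothendieckAddGroup.of (n • ⟨t + star t, F.add_mem htF (hs _ htF)⟩ : F) := by
    rw [map_nsmul, map_nsmul]
    exact h0
  exact (grothendieckAddGroup_of_eq_iff F _ _).mp h5

/-! ### Positive definite functions do not separate more than characters -/

section Separation

variable {φ : S → ℂ} (hφ : IsPosDef φ)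

theorem inner_kerVec_kerVec (s t : S) :
    inner ℂ (kerVec hφ s) (kerVec hφ t) = φ (star t + s) := by
  rw [inner_kerVec, kerVec_apply]

/-- This makes equality of kernel vectors a *-congruence on S, so identities between them can be
manipulated as in a semigroup. -/
theorem kerVec_eq_iff {a b : S} :
    kerVec hφ a = kerVec hφ b ↔ ∀ r, φ (a + r) = φ (b + r) := by
  constructor
  · intro h r
    have := congrArg (fun f => inner ℂ f (kerVec hφ (star r))) h
    simpa only [inner_kerVec_kerVec, star_star, add_comm r] using this
  · intro h
    refine RKHS.ext fun t => ?_
    rw [← inner_kerVec, ← inner_kerVec, ← inner_conj_symm, inner_kerVec_kerVec,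
      ← inner_conj_symm, inner_kerVec_kerVec, add_comm _ a, add_comm _ b, h]

theorem kerVec_add_right {a b : S} (h : kerVec hφ a = kerVec hφ b) (r : S) :
    kerVec hφ (a + r) = kerVec hφ (b + r) := by
  rw [kerVec_eq_iff] at h ⊢
  intro r'
  rw [add_assoc, h, add_assoc]

theorem IsPosDef.apply_star (hφ : IsPosDef φ) (s : S) : φ (star s) = conj (φ s) := by
  simpa using hφ.conj_symm 0 s

theorem kerVec_star {a b : S} (h : kerVec hφ a = kerVec hφ b) :
    kerVec hφ (star a) = kerVec hφ (star b) := by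
  rw [kerVec_eq_iff] at h ⊢
  intro r
  have := congrArg conj (h (star r))
  rwa [← hφ.apply_star, ← hφ.apply_star, star_add, star_add, star_star] at this

theorem norm_kerVec_sub_sq (p q : S) : ‖kerVec hφ p - kerVec hφ q‖ ^ 2 =
    (φ (star p + p)).re + (φ (star q + q)).re - 2 * (φ (star q + p)).re := by
  rw [@norm_sub_sq ℂ, ← inner_self_eq_norm_sq (𝕜 := ℂ), ← inner_self_eq_norm_sq (𝕜 := ℂ),
    inner_kerVec_kerVec, inner_kerVec_kerVec, inner_kerVec_kerVec]
  simp only [RCLike.re_eq_complex_re]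
  ring

theorem kerVec_eq_of_apply_eq {p q : S} (h1 : φ (star p + p) = φ (star p + q))
    (h2 : φ (star q + p) = φ (star q + q)) : kerVec hφ p = kerVec hφ q := by
  rw [← sub_eq_zero, ← norm_eq_zero, ← sq_eq_zero_iff, norm_kerVec_sub_sq, h1, h2, hφ.conj_symm,
    h2, Complex.conj_re]
  ring

/-- The squared distance between K_{p+x} and K_{q+x} only involves values of φ at points containing
x + x*, where p and q are interchangeable by assumption. -/
theorem kerVec_add_cancel_star {p q x : S}
    (h : kerVec hφ (p + (x + star x)) = kerVec hφ (q + (x + star x))) :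
    kerVec hφ (p + x) = kerVec hφ (q + x) := by
  rw [kerVec_eq_iff] at h
  apply kerVec_eq_of_apply_eq
  · convert h (star p) using 2 <;> rw [star_add] <;> abel
  · convert h (star q) using 2 <;> rw [star_add] <;> abel

theorem kerVec_add_cancel_nsmul {p q h : S} (hh : star h = h) (n : ℕ)
    (H : kerVec hφ (p + n • h) = kerVec hφ (q + n • h)) :
    kerVec hφ (p + h) = kerVec hφ (q + h) := by
  induction n with
  | zero => simpa using kerVec_add_right hφ H h
  | succ n ih =>
    rcases n with _ | m
    · simpa using H
    · apply ih
      -- As h is self-adjoint, 2h = h + h*; cancelling lowers the multiple of h from m + 2 to m + 1.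
      have := kerVec_add_cancel_star hφ (p := p + m • h) (q := q + m • h) (x := h) (by
        convert H using 2 <;> rw [hh, add_smul, add_smul, one_smul] <;> abel)
      rwa [add_assoc, add_assoc, ← succ_nsmul] at this

theorem kerVec_add_of_mem_starFace {p q a c : S} (hc : c ∈ starFace a)
    (h : kerVec hφ (p + c) = kerVec hφ (q + c)) : kerVec hφ (p + a) = kerVec hφ (q + a) := by
  obtain ⟨n, y, hn⟩ := hc
  have := kerVec_add_right hφ h y
  rw [add_assoc, add_assoc, hn] at this
  exact kerVec_add_cancel_star hφ (kerVec_add_cancel_nsmul hφ (by simp [add_comm]) n this)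

/-- Trading c* for a and for b gives φ(a* + a) = φ(b* + a) and φ(a* + b) = φ(b* + b). By Hermitian
symmetry all four values coincide, so K_a and K_b have distance zero. -/
theorem kerVec_eq_of_add_eq {a b c : S} (ha : c ∈ starFace a) (hb : c ∈ starFace b)
    (h : kerVec hφ (a + c) = kerVec hφ (b + c)) : kerVec hφ a = kerVec hφ b := by
  have h' := kerVec_star hφ h
  rw [star_add, star_add] at h'
  have h1 := kerVec_add_of_mem_starFace hφ (star_mem_starFace _ _ ha) h'
  have h2 := kerVec_add_of_mem_starFace hφ (star_mem_starFace _ _ hb) h'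
  have h1' := (kerVec_eq_iff hφ).mp h1 0
  have h2' := (kerVec_eq_iff hφ).mp h2 0
  rw [add_zero, add_zero] at h1' h2'
  have h3 : φ (star b + a) = φ (star b + b) := by
    rw [hφ.conj_symm, h2', ← hφ.apply_star, star_add, star_star, add_comm]
  exact kerVec_eq_of_apply_eq hφ (by rw [h1', h3, h2']) h3

/-- Multiples of a norm are norms; this realises every second difference of φ along such multiples
as a squared distance of kernel vectors. -/
theorem exists_add_star_eq_nsmul (F : AddSubmonoid S) (hs : ∀ x ∈ F, star x ∈ F) {x : S}
    (hx : x ∈ F) (i : ℕ) : ∃ p ∈ F, p + star p = i • (x + star x) := by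
  rcases Nat.even_or_odd' i with ⟨m, rfl | rfl⟩
  · refine ⟨m • (x + star x), F.nsmul_mem (F.add_mem hx (hs x hx)) m, ?_⟩
    rw [star_nsmul, star_add, star_star, add_comm (star x) x, two_mul, add_smul]
  · refine ⟨m • (x + star x) + x, F.add_mem (F.nsmul_mem (F.add_mem hx (hs x hx)) m) hx, ?_⟩
    rw [star_add, star_nsmul, star_add, star_star, add_comm (star x) x, two_mul, add_smul,
      add_smul, one_smul]
    abel

/-- A periodic convex sequence is constant; this makes torsion differences of elements `x + x*`
invisible to a positive definite function. -/
theorem exists_kerVec_add_norm_eq (F : AddSubmonoid S) (hs : ∀ x ∈ F, star x ∈ F) {x y e : S}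
    (hx : x ∈ F) (hy : y ∈ F) (he : e ∈ F) (M : ℕ)
    (h : kerVec hφ (e + (M + 1) • (x + star x)) = kerVec hφ (e + (M + 1) • (y + star y))) :
    ∃ p ∈ F, kerVec hφ (p + (x + star x)) = kerVec hφ (p + (y + star y)) := by
  set X := x + star x with hX
  set Y := y + star y with hY
  have hXs : star X = X := by simp [hX, add_comm]
  have hYs : star Y = Y := by simp [hY, add_comm]
  let f : ℕ → ℕ → ℝ := fun i j => (φ (e + star e + i • X + j • Y)).re
  have hper : ∀ i j, f (i + (M + 1)) j = f i (j + (M + 1)) := by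
    intro i j
    have := (kerVec_eq_iff hφ).mp h (star e + i • X + j • Y)
    simp only [f]
    rw [add_smul i, add_smul j]
    convert congrArg Complex.re this using 3 <;> abel
  have hconv : ∀ i j, ∃ p ∈ F, ‖kerVec hφ (p + X) - kerVec hφ (p + Y)‖ ^ 2 =
      f (i + 2) j + f i (j + 2) - 2 * f (i + 1) (j + 1) := by
    intro i j
    obtain ⟨p, hp, hpX⟩ := exists_add_star_eq_nsmul F hs hx i
    obtain ⟨q, hq, hqY⟩ := exists_add_star_eq_nsmul F hs hy j
    refine ⟨e + p + q, F.add_mem (F.add_mem he hp) hq, ?_⟩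
    rw [norm_kerVec_sub_sq]
    simp only [f, star_add, hXs, hYs]
    congr 1
    · congr 1 <;> congr 2
      · rw [add_smul, two_smul, ← hpX, ← hqY]; abel
      · rw [add_smul, two_smul, ← hpX, ← hqY]; abel
    · congr 3
      rw [add_smul, add_smul, one_smul, one_smul, ← hpX, ← hqY]; abel
  have hmono : ∀ i j, f (i + 1) (j + 1) - f i (j + 2) ≤ f (i + 2) j - f (i + 1) (j + 1) := by
    intro i j
    obtain ⟨p, -, hp⟩ := hconv i j
    have := sq_nonneg ‖kerVec hφ (p + X) - kerVec hφ (p + Y)‖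
    linarith
  -- On an antidiagonal f is convex; its increments are nondecreasing as the first index grows.
  have hchain : ∀ k j, f 2 (k + j) - f 1 (k + j + 1) ≤ f (k + 2) j - f (k + 1) (j + 1) := by
    intro k
    induction k with
    | zero => intro j; simp
    | succ k ih =>
      intro j
      have h1 := ih (j + 1)
      have h2 := hmono (k + 1) j
      rw [show k + 1 + j = k + (j + 1) by ring]
      exact h1.trans h2
  obtain ⟨p, hp, hpe⟩ := hconv 0 M
  refine ⟨p, hp, ?_⟩
  rw [← sub_eq_zero, ← norm_eq_zero, ← sq_eq_zero_iff]
  refine le_antisymm ?_ (sq_nonneg _)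
  rw [hpe]
  -- On the antidiagonal i + j = M + 2, periodicity identifies the last increment with the one from
  -- index 0 to index 1, so the second difference there is at most zero.
  have h1 := hchain M 0
  have h2 := hper 1 0
  have h3 := hper 0 1
  simp only [add_zero, zero_add] at h1 h2 h3 ⊢
  rw [show 1 + (M + 1) = M + 2 by ring] at h2 h3
  linarith

theorem starFace_le {s t : S} (h : t ∈ starFace s) : starFace t ≤ starFace s := by
  rintro x ⟨n, y, hn⟩
  refine starFace_isFace s x y (hn ▸ ?_)
  exact nsmul_mem (add_mem h (star_mem_starFace s t h)) n

/-- If all characters agree at `s` and `t`, then so do the kernel functions of every positive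
definite function. -/
theorem kerVec_eq_of_forall_character_eq {s t : S} (h : ∀ σ : Character S, σ s = σ t) :
    kerVec hφ s = kerVec hφ t := by
  have htF := mem_starFace_of_forall_character_eq h
  have hsF := mem_starFace_of_forall_character_eq fun σ => (h σ).symm
  have hFF := starFace_le hsF
  set F := starFace s with hF
  have hst := star_mem_starFace s
  obtain ⟨x, hx, y, hy, c, hc, hxy⟩ :=
    exists_norm_add_eq F (starFace_isFace s) hst h (self_mem_starFace s) htF
  obtain ⟨n, hn, c', hc', hnn⟩ :=
    exists_nsmul_norm_add_eq F (starFace_isFace s) hst h (self_mem_starFace s) htF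
  obtain ⟨M, hM⟩ : ∃ M, 2 * n = M + 1 := ⟨2 * n - 1, by omega⟩
  have hxy' := congrArg star hxy
  -- Adding s - t = X - Y to its star and multiplying by n gives 2n(X - Y) = n(s + s* - t - t*) = 0.
  -- The common summand collects what is needed to express this without subtraction.
  have key : (n • (s + star s) + n • (c + star c) + c') + (M + 1) • (x + star x) =
      (n • (s + star s) + n • (c + star c) + c') + (M + 1) • (y + star y) := by
    have h1 := congrArg₂ (fun a b => n • (a + b) + c') hxy hxy'
    simp only [star_add, star_star] at h1
    rw [← hM]
    calc _ = (c' + n • (s + star s)) + n • (c + star c) + (2 * n) • (x + star x) := by abel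
      _ = (c' + n • (t + star t)) + n • (c + star c) + (2 * n) • (x + star x) := by rw [hnn]
      _ = n • (c + (t + (x + star x)) + (star c + (star t + (star x + x)))) + c' := by
        simp only [two_mul, add_smul, smul_add]; abel
      _ = n • (c + (s + (y + star y)) + (star c + (star s + (star y + y)))) + c' := h1.symm
      _ = _ := by simp only [two_mul, add_smul, smul_add]; abel
  have hsF' := self_mem_starFace s
  obtain ⟨p, hp, hpe⟩ := exists_kerVec_add_norm_eq hφ F hst hx hy
    (add_mem (add_mem (nsmul_mem (add_mem hsF' (hst _ hsF')) n)
      (nsmul_mem (add_mem hc (hst _ hc)) n)) hc') M (congrArg _ key)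
  have hw : c + (y + star y) + p ∈ F := add_mem (add_mem hc (add_mem hy (hst _ hy))) hp
  refine kerVec_eq_of_add_eq hφ (c := c + (y + star y) + p) hw (starFace_le hsF hw) ?_
  have h1 := kerVec_add_right hφ hpe (t + c)
  rw [show s + (c + (y + star y) + p) = c + (s + (y + star y)) + p by abel, hxy]
  convert h1 using 2 <;> abel

end Separation

/-! ### Negative eigenvalues of Hermitian matrices -/

section NegEigenvalues

open Matrix

variable {n : ℕ} {M : Matrix (Fin n) (Fin n) ℂ}

theorem negEigenvalueCount_eq_card (hM : M.IsHermitian) :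
    negEigenvalueCount M = Fintype.card {i // hM.eigenvalues i < 0} := by
  rw [negEigenvalueCount, hM.roots_charpoly_eq_eigenvalues, Multiset.filter_map,
    Multiset.card_map, Fintype.card_subtype, Finset.card_def, Finset.filter_val]
  congr 1
  refine Multiset.filter_congr fun i _ => ?_
  simp

theorem dotProduct_mulVec_eq_sum_eigenvalues (hM : M.IsHermitian) (ξ : Fin n → ℂ) :
    (star ξ ⬝ᵥ M *ᵥ ξ).re = ∑ i, hM.eigenvalues i *
      ‖(star hM.eigenvectorUnitary.1 *ᵥ ξ) i‖ ^ 2 := by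
  set U : Matrix (Fin n) (Fin n) ℂ := (hM.eigenvectorUnitary).1 with hU
  have h1 : star ξ ⬝ᵥ M *ᵥ ξ =
      star (star U *ᵥ ξ) ⬝ᵥ (diagonal (RCLike.ofReal ∘ hM.eigenvalues)) *ᵥ (star U *ᵥ ξ) := by
    conv_lhs => rw [hM.spectral_theorem, Unitary.conjStarAlgAut_apply]
    rw [star_mulVec, ← dotProduct_mulVec, mulVec_mulVec, mulVec_mulVec, star_eq_conjTranspose,
      conjTranspose_conjTranspose, ← hU]
  rw [h1, dotProduct, Complex.re_sum]
  refine Finset.sum_congr rfl fun i _ => ?_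
  rw [mulVec_diagonal]
  generalize (star U *ᵥ ξ) = c
  simp only [Pi.star_apply, RCLike.star_def, Function.comp_apply]
  rw [mul_left_comm, Complex.conj_mul']
  simp [← Complex.ofReal_pow]

/-- Projecting to the negative eigencoordinates is injective on V: a vector with none of them has
nonnegative form. -/
theorem finrank_le_negEigenvalueCount (hM : M.IsHermitian) {V : Type*} [AddCommGroup V]
    [Module ℂ V] (f : V →ₗ[ℂ] (Fin n → ℂ))
    (hf : ∀ v, v ≠ 0 → (star (f v) ⬝ᵥ M *ᵥ f v).re < 0) :
    Module.finrank ℂ V ≤ negEigenvalueCount M := by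
  set U : Matrix (Fin n) (Fin n) ℂ := (hM.eigenvectorUnitary).1 with hU
  let g : V →ₗ[ℂ] ({i // hM.eigenvalues i < 0} → ℂ) :=
    (LinearMap.funLeft ℂ ℂ Subtype.val) ∘ₗ (Matrix.mulVecLin (star U)) ∘ₗ f
  have hg : Function.Injective g := by
    rw [injective_iff_map_eq_zero]
    intro v hv
    by_contra hv0
    have h1 := hf v hv0
    rw [dotProduct_mulVec_eq_sum_eigenvalues hM] at h1
    refine absurd h1 (not_lt.mpr (Finset.sum_nonneg fun i _ => ?_))
    by_cases hi : hM.eigenvalues i < 0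
    · have h2 : (star U *ᵥ f v) i = 0 := congrFun hv ⟨i, hi⟩
      rw [h2]
      simp
    · exact mul_nonneg (not_lt.mp hi) (sq_nonneg _)
  have := LinearMap.finrank_le_finrank_of_injective hg
  rwa [Module.finrank_fintype_fun_eq_card, ← negEigenvalueCount_eq_card] at this

theorem exists_linearMap_negEigenvalueCount (hM : M.IsHermitian) :
    ∃ f : (Fin (negEigenvalueCount M) → ℂ) →ₗ[ℂ] (Fin n → ℂ),
      ∀ v, v ≠ 0 → (star (f v) ⬝ᵥ M *ᵥ f v).re < 0 := by
  set U : Matrix (Fin n) (Fin n) ℂ := (hM.eigenvectorUnitary).1 with hU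
  let e : Fin (negEigenvalueCount M) ≃ {i // hM.eigenvalues i < 0} :=
    (finCongr (negEigenvalueCount_eq_card hM)).trans (Fintype.equivFin _).symm
  let g : Fin (negEigenvalueCount M) → Fin n := fun k => (e k).1
  have hg : Function.Injective g := Subtype.val_injective.comp e.injective
  refine ⟨(Matrix.mulVecLin U) ∘ₗ
    Function.ExtendByZero.linearMap ℂ g, fun v hv => ?_⟩
  rw [dotProduct_mulVec_eq_sum_eigenvalues hM]
  have h1 : star U *ᵥ ((Matrix.mulVecLin U) ∘ₗ
    Function.ExtendByZero.linearMap ℂ g) v = Function.extend g v 0 := by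
    have : star U * U = 1 := Unitary.coe_star_mul_self hM.eigenvectorUnitary
    simp [mulVec_mulVec, this]
    rfl
  rw [h1]
  have h2 : ∀ i, hM.eigenvalues i * ‖Function.extend g v 0 i‖ ^ 2 ≤ 0 := by
    intro i
    by_cases hi : ∃ k, g k = i
    · obtain ⟨k, rfl⟩ := hi
      exact mul_nonpos_of_nonpos_of_nonneg (e k).2.le (sq_nonneg _)
    · rw [Function.extend_apply' _ _ _ hi]
      simp
  obtain ⟨k, hk⟩ := Function.ne_iff.mp hv
  refine Finset.sum_neg' (fun i _ => h2 i) ⟨g k, Finset.mem_univ _, ?_⟩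
  rw [hg.extend_apply]
  exact mul_neg_of_neg_of_pos (e k).2 (pow_pos (norm_pos_iff.mpr hk) 2)

end NegEigenvalues

/-! ### Negative squares -/

theorem negEigenvalueCount_le_negSquares (ψ : S → ℂ) {n : ℕ} (s : Fin n → S) :
    (negEigenvalueCount (Matrix.of fun i j => ψ (s i + star (s j))) : ℕ∞) ≤ negSquares ψ := by
  rcases n with _ | N
  · simp [negEigenvalueCount]
  · exact le_iSup₂_of_le N s le_rfl

theorem isHermitian_of_isHermitianFun {ψ : S → ℂ} (hψ : IsHermitianFun ψ) {n : ℕ}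
    (s : Fin n → S) : (Matrix.of fun i j => ψ (s i + star (s j))).IsHermitian := by
  ext i j
  simp only [Matrix.conjTranspose_apply, Matrix.of_apply]
  rw [hψ (s i + star (s j)), star_add, star_star, add_comm]
  rfl

/-- A negative definite form on a finite-dimensional space of coefficients bounds the number of
negative squares from below. -/
theorem finrank_le_negSquares {ψ : S → ℂ} (hψ : IsHermitianFun ψ) {V : Type*} [AddCommGroup V]
    [Module ℂ V] {n : ℕ} (s : Fin n → S) (f : V →ₗ[ℂ] (Fin n → ℂ))
    (hf : ∀ v, v ≠ 0 → (∑ i, ∑ j, conj (f v i) * f v j * ψ (s i + star (s j))).re < 0) :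
    (Module.finrank ℂ V : ℕ∞) ≤ negSquares ψ := by
  refine le_trans (Nat.cast_le.mpr ?_)
    (negEigenvalueCount_le_negSquares ψ s)
  refine finrank_le_negEigenvalueCount (isHermitian_of_isHermitianFun hψ _) f fun v hv => ?_
  convert hf v hv using 2
  simp only [dotProduct, Matrix.mulVec, Matrix.of_apply, Finset.mul_sum, Pi.star_apply,
    RCLike.star_def]
  exact Finset.sum_congr rfl fun i _ => Finset.sum_congr rfl fun j _ => by ring

theorem negSquares_le {ψ : S → ℂ} (hψ : IsHermitianFun ψ) {m : ℕ∞}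
    (h : ∀ (k n : ℕ) (s : Fin n → S) (f : (Fin k → ℂ) →ₗ[ℂ] (Fin n → ℂ)),
      (∀ v, v ≠ 0 → (∑ i, ∑ j, conj (f v i) * f v j * ψ (s i + star (s j))).re < 0) →
      (k : ℕ∞) ≤ m) : negSquares ψ ≤ m := by
  refine iSup₂_le fun N s => ?_
  obtain ⟨f, hf⟩ := exists_linearMap_negEigenvalueCount (isHermitian_of_isHermitianFun hψ s)
  refine h _ _ s f fun v hv => ?_
  convert hf v hv using 2
  simp only [dotProduct, Matrix.mulVec, Matrix.of_apply, Finset.mul_sum, Pi.star_apply,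
    RCLike.star_def]
  exact Finset.sum_congr rfl fun i _ => Finset.sum_congr rfl fun j _ => by ring

/-! ### The kernel of `u_φ + I` -/

theorem forall_character_eq_of_cls_eq {s t : S} (h : cls s = cls t) (σ : Character S) :
    σ s = σ t :=
  (charCon S).eq.mp h σ

theorem cls_eq_of_forall {s t : S} (h : ∀ σ : Character S, σ s = σ t) : cls s = cls t :=
  (charCon S).eq.mpr h

theorem kerVec_eq_of_cls_eq {φ : S → ℂ} (hφ : IsPosDef φ) {s t : S} (h : cls s = cls t) :
    kerVec hφ s = kerVec hφ t :=
  kerVec_eq_of_forall_character_eq hφ (forall_character_eq_of_cls_eq h)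

theorem cls_surjective : Function.Surjective (cls : S → SepQuotient S) :=
  Quotient.mk_surjective

theorem cls_add (s t : S) : cls (s + t) = cls s + cls t := rfl

section Involution

variable {φ : S → ℂ} (hφ : IsPosDef φ) {u : S}

theorem kerVec_add_involution (h2u : cls (u + u) = 0) (s : S) :
    kerVec hφ (s + u + u) = kerVec hφ s :=
  kerVec_eq_of_cls_eq hφ (by rw [add_assoc, cls_add, h2u, add_zero])

theorem kerVec_add_star (hu : cls u = cls (star u)) (s : S) :
    kerVec hφ (s + star u) = kerVec hφ (s + u) :=
  kerVec_eq_of_cls_eq hφ (by rw [cls_add, cls_add, hu])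

theorem isHermitianFun_shift (hφ : IsPosDef φ) (hu : cls u = cls (star u)) :
    IsHermitianFun fun s => φ (s + u) := by
  intro s
  have := (kerVec_eq_iff hφ).mp (kerVec_add_star hφ hu s) 0
  simp only [add_zero] at this
  change φ (s + u) = conj (φ (star s + u))
  rw [← this, ← hφ.apply_star, star_add, star_star]

variable (u) in
/-- The span of the vectors `K_s - K_{s+u}`. -/
def antiSpan : Submodule ℂ (Hsp hφ) :=
  Submodule.span ℂ (Set.range fun s => kerVec hφ s - kerVec hφ (s + u))

variable (u) in
/-- The kernel of `u_φ + I` inside the reproducing kernel Hilbert space. -/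
theorem mem_map_kerShiftAddId_iff (x : Hsp hφ) :
    x ∈ (kerShiftAddId hφ u).map (shiftClosure hφ u).domain.subtype ↔
      (x, -x) ∈ (shiftGraph hφ u).topologicalClosure := by
  rw [← graph_shiftOp, (shiftOp_isClosable hφ u).graph_closure_eq_closure_graph,
    LinearPMap.mem_graph_iff]
  constructor
  · rintro ⟨y, hy, rfl⟩
    refine ⟨y, rfl, ?_⟩
    have h1 : (shiftClosure hφ u) y + (y : Hsp hφ) = 0 := hy
    exact eq_neg_of_add_eq_zero_left h1
  · rintro ⟨y, rfl, hy⟩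
    refine ⟨y, ?_, rfl⟩
    change (shiftClosure hφ u) y + (y : Hsp hφ) = 0
    exact add_eq_zero_iff_eq_neg.mpr hy

theorem antiSpan_le (h2u : cls (u + u) = 0) :
    antiSpan hφ u ≤ (kerShiftAddId hφ u).map (shiftClosure hφ u).domain.subtype := by
  refine Submodule.span_le.mpr ?_
  rintro _ ⟨s, rfl⟩
  rw [SetLike.mem_coe, mem_map_kerShiftAddId_iff]
  refine Submodule.le_topologicalClosure _ ?_
  have h1 : (kerVec hφ s, kerVec hφ (s + u)) ∈ shiftGraph hφ u :=
    Submodule.subset_span ⟨s, rfl⟩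
  have h2 : (kerVec hφ (s + u), kerVec hφ s) ∈ shiftGraph hφ u :=
    Submodule.subset_span ⟨s + u, by simp only [kerVec_add_involution hφ h2u]⟩
  have h3 := Submodule.sub_mem _ h1 h2
  rw [Prod.mk_sub_mk] at h3
  rwa [neg_sub]

variable (u) in
theorem le_antiSpan [FiniteDimensional ℂ (antiSpan hφ u)] :
    (kerShiftAddId hφ u).map (shiftClosure hφ u).domain.subtype ≤ antiSpan hφ u := by
  intro x hx
  rw [mem_map_kerShiftAddId_iff] at hx
  have hc : IsClosed {p : Hsp hφ × Hsp hφ | p.1 - p.2 ∈ antiSpan hφ u} :=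
    (Submodule.closed_of_finiteDimensional (antiSpan hφ u)).preimage
      (continuous_fst.sub continuous_snd)
  have hsub : (shiftGraph hφ u : Set (Hsp hφ × Hsp hφ)) ⊆
      {p : Hsp hφ × Hsp hφ | p.1 - p.2 ∈ antiSpan hφ u} := by
    have : shiftGraph hφ u ≤ (antiSpan hφ u).comap
        (LinearMap.fst ℂ (Hsp hφ) (Hsp hφ) - LinearMap.snd ℂ (Hsp hφ) (Hsp hφ)) := by
      refine Submodule.span_le.mpr ?_
      rintro _ ⟨s, rfl⟩
      exact Submodule.subset_span ⟨s, rfl⟩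
    exact this
  -- The difference of components maps the graph into `antiSpan`, which is closed because
  -- finite-dimensional; the pair (x, -x) then yields 2x.
  have h1 : x - -x ∈ antiSpan hφ u := closure_minimal hsub hc hx
  rw [sub_neg_eq_add, ← two_smul ℂ x] at h1
  exact (Submodule.smul_mem_iff _ two_ne_zero).mp h1

theorem toENat_rank_kerShiftAddId (h2u : cls (u + u) = 0) :
    Cardinal.toENat (Module.rank ℂ (kerShiftAddId hφ u)) =
      Cardinal.toENat (Module.rank ℂ (antiSpan hφ u)) := by
  have h1 : Module.rank ℂ (kerShiftAddId hφ u) =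
      Module.rank ℂ ((kerShiftAddId hφ u).map (shiftClosure hφ u).domain.subtype) :=
    (Submodule.equivMapOfInjective _ (Submodule.injective_subtype _) _).rank_eq
  rw [h1]
  have hle := antiSpan_le hφ h2u
  by_cases hfin : FiniteDimensional ℂ (antiSpan hφ u)
  · rw [le_antisymm (le_antiSpan hφ u) hle]
  · have h2 : Cardinal.aleph0 ≤ Module.rank ℂ (antiSpan hφ u) := by
      rwa [← not_lt, Module.rank_lt_aleph0_iff]
    rw [Cardinal.toENat_eq_top.mpr h2,
      Cardinal.toENat_eq_top.mpr (h2.trans (Submodule.rank_mono hle))]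

theorem sum_shift_eq_inner (r : S) {ι : Type*} [Fintype ι] (s : ι → S) (ξ : ι → ℂ) :
    ∑ i, ∑ j, conj (ξ i) * ξ j * φ (s i + star (s j) + r) =
      inner ℂ (∑ i, ξ i • kerVec hφ (s i + r)) (∑ j, ξ j • kerVec hφ (s j)) := by
  rw [sum_inner]
  refine Finset.sum_congr rfl fun i _ => ?_
  rw [inner_sum]
  refine Finset.sum_congr rfl fun j _ => ?_
  rw [inner_smul_left, inner_smul_right, inner_kerVec_kerVec, mul_assoc]
  congr 3
  abel

/-- A combination of the K_s annihilated by I minus the shift is fixed by the shift, so its form is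
a squared norm. Hence negative definite coefficient spaces inject into `antiSpan`. -/
theorem negSquares_shift_le (hu : cls u = cls (star u)) :
    negSquares (fun s => φ (s + u)) ≤ Cardinal.toENat (Module.rank ℂ (antiSpan hφ u)) := by
  refine negSquares_le (isHermitianFun_shift hφ hu) fun k n s f hf => ?_
  let g : (Fin n → ℂ) →ₗ[ℂ] antiSpan hφ u :=
    Fintype.linearCombination ℂ
      fun i => ⟨kerVec hφ (s i) - kerVec hφ (s i + u), Submodule.subset_span ⟨s i, rfl⟩⟩
  have hg : Function.Injective (g ∘ₗ f) := by
    rw [injective_iff_map_eq_zero]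
    intro v hv
    by_contra hv0
    have h1 := hf v hv0
    rw [sum_shift_eq_inner hφ u s (f v)] at h1
    have h2 : ∑ i, f v i • kerVec hφ (s i) = ∑ i, f v i • kerVec hφ (s i + u) := by
      have h3 := congrArg Subtype.val hv
      simp only [LinearMap.comp_apply, g, Fintype.linearCombination_apply,
        AddSubmonoidClass.coe_finsetSum, Submodule.coe_smul, smul_sub, Finset.sum_sub_distrib,
        ZeroMemClass.coe_zero] at h3
      exact sub_eq_zero.mp h3
    rw [h2] at h1
    exact absurd h1 (not_lt.mpr (inner_self_nonneg (𝕜 := ℂ)))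
  rw [Cardinal.natCast_le_toENat]
  have := LinearMap.lift_rank_le_of_injective _ hg
  simpa using this

/-- On `antiSpan` the shift is -1, so the form equals -‖w‖². -/
theorem le_negSquares_shift (h2u : cls (u + u) = 0) (hu : cls u = cls (star u)) :
    Cardinal.toENat (Module.rank ℂ (antiSpan hφ u)) ≤ negSquares (fun s => φ (s + u)) := by
  refine ENat.forall_natCast_le_iff_le.mp fun k hk => ?_
  rw [Cardinal.natCast_le_toENat] at hk
  obtain ⟨b, hb, hspan, hli⟩ := exists_linearIndependent ℂ
    (Set.range fun s => kerVec hφ s - kerVec hφ (s + u))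
  have hcard : Module.rank ℂ (antiSpan hφ u) = Cardinal.mk b := by
    rw [antiSpan, ← hspan, rank_span_set hli]
  rw [hcard] at hk
  obtain ⟨e⟩ : Nonempty (Fin k ↪ b) := by
    rw [← Cardinal.lift_mk_le']
    simpa using hk
  choose s hs using fun i => hb (e i).2
  have hw : LinearIndependent ℂ fun i => kerVec hφ (s i) - kerVec hφ (s i + u) := by
    rw [show (fun i => kerVec hφ (s i) - kerVec hφ (s i + u)) = Subtype.val ∘ e from funext hs]
    exact hli.comp e e.injective
  -- Coefficients v at the s_i and -v at the s_i + u represent w = ∑ v_i (K_{s_i} - K_{s_i+u}).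
  let f : (Fin k → ℂ) →ₗ[ℂ] (Fin (k + k) → ℂ) :=
    { toFun := fun v => Fin.append v (-v)
      map_add' := fun v w => by
        ext i
        induction i using Fin.addCases <;>
          simp only [Fin.append_left, Fin.append_right, Pi.add_apply, Pi.neg_apply, neg_add]
      map_smul' := fun c v => by
        ext i
        induction i using Fin.addCases <;>
          simp only [Fin.append_left, Fin.append_right, Pi.smul_apply, Pi.neg_apply, smul_neg,
            RingHom.id_apply] }
  have hf : ∀ v, f v = Fin.append v (-v) := fun v => rfl
  have := finrank_le_negSquares (isHermitianFun_shift hφ hu)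
    (Fin.append s (fun i => s i + u)) f (fun v hv => ?_)
  · simpa using this
  · rw [sum_shift_eq_inner hφ u _ (f v), hf]
    set w := ∑ i, v i • (kerVec hφ (s i) - kerVec hφ (s i + u)) with hw'
    have hw0 : w ≠ 0 := fun h0 => hv (funext (Fintype.linearIndependent_iff.mp hw v h0))
    have h1 : ∑ j, Fin.append v (-v) j • kerVec hφ (Fin.append s (fun i => s i + u) j) = w := by
      rw [Fin.sum_univ_add, hw']
      simp only [Fin.append_left, Fin.append_right, Pi.neg_apply, smul_sub,
        Finset.sum_sub_distrib, neg_smul, Finset.sum_neg_distrib]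
      rw [sub_eq_add_neg]
    have h2 : ∑ j, Fin.append v (-v) j • kerVec hφ (Fin.append s (fun i => s i + u) j + u) =
        -w := by
      rw [Fin.sum_univ_add, hw']
      simp only [Fin.append_left, Fin.append_right, Pi.neg_apply, smul_sub,
        Finset.sum_sub_distrib, neg_smul, Finset.sum_neg_distrib, kerVec_add_involution hφ h2u]
      abel
    rw [h1, h2, inner_neg_left, inner_self_eq_norm_sq_to_K]
    have : 0 < ‖w‖ := norm_pos_iff.mpr hw0
    simp only [Complex.coe_algebraMap, ← Complex.ofReal_pow, Complex.neg_re, Complex.ofReal_re]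
    nlinarith

theorem negSquares_shift (h2u : cls (u + u) = 0) (hu : cls u = cls (star u)) :
    negSquares (fun s => φ (s + u)) =
      Cardinal.toENat (Module.rank ℂ (kerShiftAddId hφ u)) := by
  rw [toENat_rank_kerShiftAddId hφ h2u]
  exact le_antisymm (negSquares_shift_le hφ hu) (le_negSquares_shift hφ h2u hu)

theorem negSquares_shift_lt_top_iff (h2u : cls (u + u) = 0) (hu : cls u = cls (star u)) :
    negSquares (fun s => φ (s + u)) < ⊤ ↔ FiniteDimensional ℂ (kerShiftAddId hφ u) := by
  rw [negSquares_shift hφ h2u hu, Cardinal.toENat_lt_top, Module.rank_lt_aleph0_iff]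

end Involution

/-! ### Finiteness of the set of moved classes -/

/-- The generator K_s - K_{s+u} depends only on [s] and vanishes when u fixes [s]. -/
theorem finiteDimensional_kerShiftAddId {φ : S → ℂ} (hφ : IsPosDef φ) {u : S}
    (h2u : cls (u + u) = 0)
    (hfin : {x : SepQuotient S | cls u + x ≠ x}.Finite) :
    FiniteDimensional ℂ (kerShiftAddId hφ u) := by
  refine Module.rank_lt_aleph0_iff.mp (Cardinal.toENat_lt_top.mp ?_)
  rw [toENat_rank_kerShiftAddId hφ h2u, Cardinal.toENat_lt_top, Module.rank_lt_aleph0_iff]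
  obtain ⟨rep, hrep⟩ := (cls_surjective (S := S)).hasRightInverse
  let g : SepQuotient S → Hsp hφ := fun x => kerVec hφ (rep x) - kerVec hφ (rep x + u)
  have hg : ∀ s, kerVec hφ s - kerVec hφ (s + u) = g (cls s) := fun s =>
    congrArg₂ _ (kerVec_eq_of_cls_eq hφ (hrep (cls s)).symm)
      (kerVec_eq_of_cls_eq hφ (by rw [cls_add, cls_add, hrep (cls s)]))
  refine Module.Finite.span_of_finite ℂ
    (((hfin.image g).insert 0).subset (t := Set.range _) ?_)
  rintro _ ⟨s, rfl⟩
  by_cases hs : cls u + cls s = cls s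
  · left
    rw [sub_eq_zero]
    exact kerVec_eq_of_cls_eq hφ (by rw [cls_add, add_comm, hs])
  · exact Or.inr ⟨cls s, hs, (hg s).symm⟩

/-! ### Characters with `σ u = -1` -/

/-- The pointwise product of two characters. -/
def Character.mul (σ τ : Character S) : Character S where
  toFun s := σ s * τ s
  map_add' s t := by rw [σ.map_add', τ.map_add']; ring
  map_star' s := by rw [σ.map_star', τ.map_star', map_mul]
  ne_zero' := ⟨0, by simp [σ.map_zero, τ.map_zero]⟩

/-- The pointwise power of a character. -/
def Character.npow (σ : Character S) (n : ℕ) : Character S where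
  toFun s := σ s ^ n
  map_add' s t := by rw [σ.map_add', mul_pow]
  map_star' s := by rw [σ.map_star', map_pow]
  ne_zero' := ⟨0, by simp [σ.map_zero]⟩

theorem Character.sq_eq_one {u : S} (h2u : cls (u + u) = 0) (σ : Character S) :
    σ u = 1 ∨ σ u = -1 := by
  have := forall_character_eq_of_cls_eq (s := u + u) (t := 0) h2u σ
  rw [σ.map_add', σ.map_zero] at this
  exact mul_self_eq_one_iff.mp this

/-- Moved classes are determined by the values of the finitely many characters with σ(u) = -1, and
each of these takes finitely many values. -/
theorem finite_moved_classes {u : S} (h2u : cls (u + u) = 0)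
    (hfin : {σ : Character S | σ u = -1}.Finite) :
    {x : SepQuotient S | cls u + x ≠ x}.Finite := by
  have : Finite {σ : Character S | σ u = -1} := hfin
  -- each such character takes finitely many values
  have hvals : ∀ σ : {σ : Character S | σ u = -1}, (Set.range σ.1.toFun).Finite := by
    rintro ⟨σ, hσ⟩
    have hodd : ∀ k : ℕ, σ.npow (2 * k + 1) u = -1 := by
      intro k
      change σ u ^ (2 * k + 1) = -1
      rw [Set.mem_ofPred_eq.mp hσ]
      exact Odd.neg_one_pow ⟨k, rfl⟩
    -- Two distinct odd powers of σ coincide by pigeonhole, so all values of σ are roots of one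
    -- nonzero polynomial.
    obtain ⟨k, l, hkl, h⟩ := Finite.exists_ne_map_eq_of_infinite
      fun k : ℕ => (⟨σ.npow (2 * k + 1), hodd k⟩ : {σ : Character S | σ u = -1})
    have hpow : ∀ s, σ s ^ (2 * k + 1) = σ s ^ (2 * l + 1) := fun s =>
      congrFun (congrArg (fun σ => σ.1.toFun) h) s
    have hne : (Polynomial.X ^ (2 * k + 1) - Polynomial.X ^ (2 * l + 1) : Polynomial ℂ) ≠ 0 := by
      rw [sub_ne_zero]
      intro h
      have := congrArg Polynomial.natDegree h
      rw [Polynomial.natDegree_X_pow, Polynomial.natDegree_X_pow] at this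
      omega
    refine (Polynomial.finite_setOfPred_isRoot hne).subset ?_
    rintro _ ⟨s, rfl⟩
    simp [Polynomial.IsRoot, hpow s]
  let ev : S → {σ : Character S | σ u = -1} → ℂ := fun s σ => σ.1 s
  have hrange : (Set.range ev).Finite := by
    refine (Set.Finite.pi' hvals).subset ?_
    rintro _ ⟨s, rfl⟩ σ
    exact ⟨s, rfl⟩
  obtain ⟨rep, hrep⟩ := (cls_surjective (S := S)).hasRightInverse
  let evq : SepQuotient S → {σ : Character S | σ u = -1} → ℂ := fun x => ev (rep x)
  refine Set.Finite.of_finite_image (f := evq)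
    (hrange.subset (by rintro _ ⟨x, -, rfl⟩; exact ⟨_, rfl⟩)) ?_
  intro x hx y hy hxy
  rw [← hrep x, ← hrep y]
  refine cls_eq_of_forall fun τ => ?_
  have hag : ∀ σ : Character S, σ u = -1 → σ (rep x) = σ (rep y) := fun σ hσ =>
    congrFun hxy ⟨σ, hσ⟩
  rcases τ.sq_eq_one h2u with hτ | hτ
  -- Since x is moved, some σ with σ(u) = -1 does not vanish at x. The product στ is again -1 at u,
  -- and the nonzero factor σ(x) = σ(y) cancels.
  · obtain ⟨σ, hσ, hσx⟩ : ∃ σ : Character S, σ u = -1 ∧ σ (rep x) ≠ 0 := by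
      by_contra! hcon
      refine hx ?_
      rw [← hrep x, ← cls_add]
      refine cls_eq_of_forall fun σ => ?_
      rw [σ.map_add']
      rcases σ.sq_eq_one h2u with h | h
      · rw [h, one_mul]
      · rw [hcon σ h, mul_zero]
    have h1 := hag (σ.mul τ) (by change σ u * τ u = -1; rw [hσ, hτ, mul_one])
    change σ (rep x) * τ (rep x) = σ (rep y) * τ (rep y) at h1
    rw [← hag σ hσ] at h1
    exact mul_left_cancel₀ hσx h1
  · exact hag τ hτ

/-! ### Linear independence of characters -/

theorem linearIndependent_character {ι : Type*} {σ : ι → Character S}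
    (hσ : Function.Injective σ) : LinearIndependent ℂ fun i => (σ i).toFun := by
  let g : ι → (Multiplicative S →* ℂ) := fun i =>
    { toFun := fun s => σ i s.toAdd
      map_one' := (σ i).map_zero
      map_mul' := fun s t => (σ i).map_add' _ _ }
  have hg : Function.Injective g := fun i j h =>
    hσ (Character.ext_fun fun s => DFunLike.congr_fun h (Multiplicative.ofAdd s))
  exact (linearIndependent_monoidHom (Multiplicative S) ℂ).comp g hg

/-- Distinct characters are linearly independent already on finitely many points. -/
theorem exists_points_of_injective {N : ℕ} {σ : Fin N → Character S}
    (hσ : Function.Injective σ) : ∃ s : Fin N → S, ∀ ξ : Fin N → ℂ,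
      (∀ n, ∑ i, ξ i * σ n (s i) = 0) → ξ = 0 := by
  let w : S → Fin N → ℂ := fun s n => σ n s
  have hspan : Submodule.span ℂ (Set.range w) = ⊤ := by
    by_contra hne
    obtain ⟨f, hf0, hf⟩ := Submodule.exists_le_ker_of_lt_top _ (lt_top_iff_ne_top.mpr hne)
    refine hf0 (LinearMap.pi_ext' fun n => LinearMap.ext_ring ?_)
    -- A functional vanishing on every vector of values is a linear relation between the characters.
    have h1 := Fintype.linearIndependent_iff.mp (linearIndependent_character hσ)
      (fun n => f (Pi.single n 1)) (by
        funext s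
        have h2 : f (w s) = 0 := hf (Submodule.subset_span ⟨s, rfl⟩)
        rw [LinearMap.pi_apply_eq_sum_univ f (w s)] at h2
        have h3 : ∀ i : Fin N, (fun j => if i = j then (1 : ℂ) else 0) = Pi.single i 1 := by
          intro i
          ext j
          simp [Pi.single_apply, eq_comm]
        simp only [h3] at h2
        simpa [w, mul_comm] using h2) n
    simpa using h1
  obtain ⟨b, hb, hbspan, hli⟩ := exists_linearIndependent ℂ (Set.range w)
  have hcard : Cardinal.mk b = N := by
    rw [← rank_span_set hli, hbspan, hspan, rank_top]
    simp
  obtain ⟨e⟩ : Nonempty (Fin N ↪ b) := by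
    rw [← Cardinal.lift_mk_le']
    simp [hcard]
  choose s hs using fun i => hb (e i).2
  refine ⟨s, fun ξ hξ => funext fun i => ?_⟩
  refine Fintype.linearIndependent_iff.mp (hli.comp e e.injective) ξ ?_ i
  funext n
  rw [Finset.sum_apply, Pi.zero_apply, ← hξ n]
  refine Finset.sum_congr rfl fun i _ => ?_
  rw [Pi.smul_apply, Function.comp_apply, ← hs i, smul_eq_mul]

/-! ### Moment functions with infinitely many negative squares -/

open MeasureTheory

theorem measurable_eval (s : S) : Measurable fun σ : Character S => σ s :=
  (comap_measurable _).mono (le_iSup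
    (fun s : S => MeasurableSpace.comap (fun σ : Character S => σ s) inferInstance) s) le_rfl

theorem sum_eq_integral_norm_sq {μ : Measure (Character S)} {φ : S → ℂ}
    (hL : ∀ s : S, MemLp (fun σ : Character S => σ s) 2 μ)
    (hφ : ∀ s : S, φ s = ∫ σ : Character S, σ s ∂μ) {ι : Type*} [Fintype ι] (s : ι → S)
    (ξ : ι → ℂ) : ∑ i, ∑ j, ξ i * conj (ξ j) * φ (s i + star (s j)) =
      ((∫ σ : Character S, ‖∑ i, ξ i * σ (s i)‖ ^ 2 ∂μ : ℝ) : ℂ) := by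
  have hint : ∀ i j, Integrable
      (fun σ : Character S => ξ i * conj (ξ j) * σ (s i + star (s j))) μ := by
    intro i j
    have h1 : Integrable (fun σ : Character S => conj (σ (s j)) * σ (s i)) μ :=
      MemLp.integrable_mul (hL (s j)).star (hL (s i))
    refine (h1.const_mul (ξ i * conj (ξ j))).congr (Filter.Eventually.of_forall fun σ => ?_)
    simp only [σ.map_add', σ.map_star']
    ring
  have h2 : ∀ σ : Character S, ((‖∑ i, ξ i * σ (s i)‖ ^ 2 : ℝ) : ℂ) =
      ∑ i, ∑ j, ξ i * conj (ξ j) * σ (s i + star (s j)) := by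
    intro σ
    rw [Complex.ofReal_pow, ← Complex.mul_conj', map_sum, Finset.sum_mul_sum]
    refine Finset.sum_congr rfl fun i _ => Finset.sum_congr rfl fun j _ => ?_
    rw [σ.map_add', σ.map_star', map_mul]
    ring
  rw [← integral_complex_ofReal]
  simp_rw [h2, hφ, ← integral_const_mul]
  rw [integral_finsetSum _ fun i _ => integrable_finsetSum _ fun j _ => hint i j]
  exact Finset.sum_congr rfl fun i _ => (integral_finsetSum _ fun j _ => hint i j).symm

/-- A pointwise bounded sequence of characters carries a finite measure with full support. -/
theorem exists_measure_of_bounded (σ : ℕ → Character S)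
    (hbdd : ∀ s, ∃ C : ℝ, ∀ n, ‖σ n s‖ ≤ C) :
    ∃ μ : Measure (Character S), (∀ s : S, MemLp (fun σ : Character S => σ s) 2 μ) ∧
      ∀ p : Character S → Prop, MeasurableSet {τ | p τ} →
        ((∀ᵐ τ ∂μ, p τ) ↔ ∀ n, p (σ n)) := by
  -- The weights 2⁻ⁿ are summable, giving finite mass, and nonzero, so almost everywhere means at
  -- every σ_n.
  let μ : Measure (Character S) :=
    Measure.sum fun n => ((2 : ENNReal)⁻¹ ^ n) • Measure.dirac (σ n)
  have hae : ∀ p : Character S → Prop, MeasurableSet {τ | p τ} →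
      ((∀ᵐ τ ∂μ, p τ) ↔ ∀ n, p (σ n)) := by
    intro p hp
    rw [Measure.ae_sum_iff]
    refine forall_congr' fun n => ?_
    rw [Measure.ae_ennreal_smul_measure_iff (by simp), ae_dirac_iff hp]
  have hfin : IsFiniteMeasure μ := by
    refine ⟨?_⟩
    rw [Measure.sum_apply _ MeasurableSet.univ]
    simp only [Measure.smul_apply, measure_univ, smul_eq_mul, mul_one, ENNReal.tsum_geometric,
      ENNReal.one_sub_inv_two, inv_inv]
    exact ENNReal.ofNat_lt_top
  refine ⟨μ, fun s => ?_, hae⟩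
  obtain ⟨C, hC⟩ := hbdd s
  exact MemLp.of_bound (measurable_eval s).aestronglyMeasurable C
    ((hae _ (measurableSet_le (measurable_eval s).norm measurable_const)).mpr hC)

theorem exists_isMoment_negSquares_eq_top {u : S} (hu : cls u = cls (star u))
    {σ : ℕ → Character S} (hσ : Function.Injective σ) (hσu : ∀ n, σ n u = -1)
    (hbdd : ∀ s, ∃ C : ℝ, ∀ n, ‖σ n s‖ ≤ C) :
    ∃ φ : S → ℂ, IsMoment φ ∧ negSquares (fun s => φ (s + u)) = ⊤ := by
  obtain ⟨μ, hL, hae⟩ := exists_measure_of_bounded σ hbdd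
  let φ : S → ℂ := fun s => ∫ τ : Character S, τ s ∂μ
  have hm : IsMoment φ := ⟨μ, hL, fun s => rfl⟩
  refine ⟨φ, hm, ENat.eq_top_iff_forall_ge.mpr fun N => ?_⟩
  have hneg : ∀ s, φ (s + u) = - φ s := by
    intro s
    have h1 : ∀ᵐ τ ∂μ, τ.toFun u = -1 :=
      (hae _ (measurable_eval u (measurableSet_singleton _))).mpr hσu
    rw [← integral_neg]
    refine integral_congr_ae ?_
    filter_upwards [h1] with τ hτ
    rw [τ.map_add', hτ, mul_neg_one]
  obtain ⟨s, hs⟩ := exists_points_of_injective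
    (hσ.comp (Fin.val_injective (n := N)))
  have := finrank_le_negSquares (isHermitianFun_shift hm.isPosDef hu) s LinearMap.id
    fun v hv => ?_
  · simpa using this
  · have h1 := sum_eq_integral_norm_sq hL (fun s => rfl : ∀ s, φ s = _) s (fun i => conj (v i))
    simp only [Complex.conj_conj] at h1
    simp only [LinearMap.id_apply, hneg, mul_neg, Finset.sum_neg_distrib, h1, Complex.neg_re,
      Complex.ofReal_re, neg_lt_zero]
    refine lt_of_le_of_ne (integral_nonneg fun τ => sq_nonneg _) fun h0 => hv ?_
    have hmeas : Measurable fun τ : Character S => ∑ i, conj (v i) * τ (s i) :=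
      Finset.measurable_sum _ fun i _ => (measurable_eval (s i)).const_mul _
    have hint : Integrable (fun τ : Character S => ‖∑ i, conj (v i) * τ (s i)‖ ^ 2) μ :=
      (memLp_finsetSum _ fun i _ => (hL (s i)).const_mul (conj (v i))).norm.integrable_sq
    have h2 := (integral_eq_zero_iff_of_nonneg (fun τ => sq_nonneg _) hint).mp h0.symm
    -- A vanishing integral forces the trigonometric-type sum to vanish at every σ_n; the chosen
    -- points then give v = 0.
    have h3 := (hae _ (measurableSet_eq_fun (hmeas.norm.pow_const 2) measurable_const)).mp h2
    have h4 := hs (fun i => conj (v i)) fun n =>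
      norm_eq_zero.mp (pow_eq_zero_iff two_ne_zero |>.mp (h3 n))
    funext i
    simpa using congrFun h4 i

/-! ### Bounded sequences of characters -/

/-- The character with the phase of `σ` and the `t`-th power of its modulus. -/
def Character.twist (σ : Character S) (t : ℝ) : Character S where
  -- At zeros of σ the convention 0 / 0 = 0 gives the value 0, even for t = 0, where 0 ^ 0 = 1.
  toFun s := σ s / ‖σ s‖ * ((‖σ s‖ ^ t : ℝ) : ℂ)
  map_add' s r := by
    rw [σ.map_add', norm_mul, Real.mul_rpow (norm_nonneg _) (norm_nonneg _), Complex.ofReal_mul,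
      Complex.ofReal_mul, mul_div_mul_comm]
    ring
  map_star' s := by
    rw [σ.map_star', RCLike.norm_conj, map_mul, map_div₀, Complex.conj_ofReal,
      Complex.conj_ofReal]
  ne_zero' := ⟨0, by simp [σ.map_zero]⟩

theorem Character.twist_apply (σ : Character S) (t : ℝ) (s : S) :
    σ.twist t s = σ s / ‖σ s‖ * ((‖σ s‖ ^ t : ℝ) : ℂ) := rfl

theorem Character.norm_twist (σ : Character S) (t : ℝ) {s : S} (h : σ s ≠ 0) :
    ‖σ.twist t s‖ = ‖σ s‖ ^ t := by
  have h1 : ‖σ s‖ ≠ 0 := norm_ne_zero_iff.mpr h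
  rw [σ.twist_apply, norm_mul, norm_div, Complex.norm_real, Complex.norm_real, norm_norm,
    div_self h1, one_mul, Real.norm_of_nonneg (Real.rpow_nonneg (norm_nonneg _) _)]

theorem Character.twist_eq_neg_one (σ : Character S) (t : ℝ) {u : S} (h : σ u = -1) :
    σ.twist t u = -1 := by
  simp [σ.twist_apply, h]

/-- Either infinitely many phases σ/|σ| occur, all bounded by 1, or some σ has a value of modulus
neither 0 nor 1. In the latter case the powers |σ|^{1/(n+1)} with the phase of σ are distinct and
bounded by max(1, |σ|). -/
theorem exists_bounded_sequence {u : S} (h : {σ : Character S | σ u = -1}.Infinite) :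
    ∃ σ : ℕ → Character S, Function.Injective σ ∧ (∀ n, σ n u = -1) ∧
      ∀ s, ∃ C : ℝ, ∀ n, ‖σ n s‖ ≤ C := by
  by_cases hinf : ((fun σ : Character S => σ.twist 0) '' {σ | σ u = -1}).Infinite
  · let e := hinf.natEmbedding
    refine ⟨fun n => (e n).1, Subtype.val_injective.comp e.injective, fun n => ?_,
      fun s => ⟨1, fun n => ?_⟩⟩
    · obtain ⟨σ, hσ, hn⟩ := (e n).2
      simp only [← hn]
      exact σ.twist_eq_neg_one 0 hσ
    · obtain ⟨σ, -, hn⟩ := (e n).2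
      simp only [← hn]
      by_cases h0 : σ s = 0
      · simp [σ.twist_apply, h0]
      · rw [σ.norm_twist 0 h0, Real.rpow_zero]
  · obtain ⟨σ, hσ, hne⟩ : ∃ σ : Character S, σ u = -1 ∧ σ.twist 0 ≠ σ := by
      by_contra! hcon
      refine hinf (h.mono fun σ hσ => ⟨σ, hσ, hcon σ hσ⟩)
    obtain ⟨s, hs⟩ : ∃ s, σ.twist 0 s ≠ σ s := by
      by_contra! hcon
      exact hne (Character.ext_fun hcon)
    have hs0 : σ s ≠ 0 := fun h0 => hs (by simp [σ.twist_apply, h0])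
    have hs1 : ‖σ s‖ ≠ 1 := fun h1 => hs (by simp [σ.twist_apply, h1])
    have hpos : 0 < ‖σ s‖ := norm_pos_iff.mpr hs0
    refine ⟨fun n => σ.twist (1 / ((n : ℝ) + 1)), fun m n hmn => ?_,
      fun n => σ.twist_eq_neg_one _ hσ, fun r => ⟨max 1 ‖σ r‖, fun n => ?_⟩⟩
    · have h1 := congrArg (fun τ : Character S => ‖τ s‖) hmn
      simp only [σ.norm_twist _ hs0] at h1
      have h2 := Real.rpow_right_inj hpos hs1 |>.mp h1
      simpa using h2
    · by_cases h0 : σ r = 0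
      · simp [σ.twist_apply, h0]
      · rw [σ.norm_twist _ h0]
        rcases le_total ‖σ r‖ 1 with h1 | h1
        · exact le_max_of_le_left (Real.rpow_le_one (norm_nonneg _) h1 (by positivity))
        · refine le_max_of_le_right ?_
          have h2 : 1 / ((n : ℝ) + 1) ≤ 1 := by
            rw [div_le_one (by positivity)]
            linarith [n.cast_nonneg (α := ℝ)]
          simpa using Real.rpow_le_rpow_of_exponent_le h1 h2

theorem finite_of_negSquares_lt_top {u : S} (hu : cls u = cls (star u))
    (h : ∀ φ : S → ℂ, IsMoment φ → negSquares (fun s => φ (s + u)) < ⊤) :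
    {σ : Character S | σ u = -1}.Finite := by
  by_contra hinf
  obtain ⟨σ, hσ, hσu, hbdd⟩ := exists_bounded_sequence hinf
  obtain ⟨φ, hφ, htop⟩ := exists_isMoment_negSquares_eq_top hu hσ hσu hbdd
  exact (h φ hφ).ne htop

end StarSemigroup

end

theorem proposition12 {S : Type*} [AddCommMonoid S] [StarAddMonoid S] (u : S)
    (h2u : StarSemigroup.cls (u + u) = 0)
    (hu : StarSemigroup.cls u = StarSemigroup.cls (star u)) :
    (∀ (φ : S → ℂ) (hφ : StarSemigroup.IsPosDef φ),
      StarSemigroup.IsHermitianFun (fun s => φ (s + u)) ∧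
      StarSemigroup.negSquares (fun s => φ (s + u)) =
        Cardinal.toENat (Module.rank ℂ (StarSemigroup.kerShiftAddId hφ u))) ∧
    List.TFAE [
      {x : StarSemigroup.SepQuotient S | StarSemigroup.cls u + x ≠ x}.Finite,
      {σ : StarSemigroup.Character S | σ u = -1}.Finite,
      ∀ (φ : S → ℂ) (hφ : StarSemigroup.IsMoment φ),
        FiniteDimensional ℂ (StarSemigroup.kerShiftAddId hφ.isPosDef u),
      ∀ (φ : S → ℂ) (hφ : StarSemigroup.IsPosDef φ),
        FiniteDimensional ℂ (StarSemigroup.kerShiftAddId hφ u),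
      ∀ φ : S → ℂ, StarSemigroup.IsPosDef φ →
        StarSemigroup.negSquares (fun s => φ (s + u)) < ⊤,
      ∀ φ : S → ℂ, StarSemigroup.IsMoment φ →
        StarSemigroup.negSquares (fun s => φ (s + u)) < ⊤] := by
  refine ⟨fun φ hφ => ⟨StarSemigroup.isHermitianFun_shift hφ hu,
    StarSemigroup.negSquares_shift hφ h2u hu⟩, ?_⟩
  tfae_have 1 → 4 := fun h φ hφ => StarSemigroup.finiteDimensional_kerShiftAddId hφ h2u h
  tfae_have 4 → 3 := fun h φ hφ => h φ hφ.isPosDef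
  tfae_have 4 → 5 := fun h φ hφ =>
    (StarSemigroup.negSquares_shift_lt_top_iff hφ h2u hu).mpr (h φ hφ)
  tfae_have 5 → 6 := fun h φ hφ => h φ hφ.isPosDef
  tfae_have 3 → 6 := fun h φ hφ =>
    (StarSemigroup.negSquares_shift_lt_top_iff hφ.isPosDef h2u hu).mpr (h φ hφ)
  tfae_have 6 → 2 := StarSemigroup.finite_of_negSquares_lt_top hu
  tfae_have 2 → 1 := StarSemigroup.finite_moved_classes h2u
  tfae_finish
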